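/- **Theorem 1 (Lindeberg CLT for cluster functionals).** Let $E\subseteq\mathbb{R}^d$ be a measurable subspace (with the Borel $\sigma$-field of $\mathbb{R}^d$ restricted to $E$) such that $0\in E$, and let $E_\cup$ be the set of finite blocks $(x_1,\dots,x_r)$, $r\ge 1$, $x_i\in E$, with the $\sigma$-field induced by the Borel $\sigma$-fields on the $E^r$. The core $x^c$ of a block $x$ is its sub-block from the first to the last non-zero entry (and the one-entry block $0$ if all entries of $x$ vanish). A cluster functional is a measurable $f:E_\cup\to\mathbb{R}$ with $f(x)=f(x^c)$ for all $x\in E_\cup$ and $f(0,\dots,0)=0$ for null blocks of every length. Let $(X_{n,i})_{1\le i\le n,\,n\in\mathbb{N}}$ be $E$-valued random variables on a probability space such that each row $(X_{n,i})_{1\le i\le n}$ is strictly stationary. Put $v_n=\mathbb{P}\{X_{n,1}\neq 0\}$, let $(r_n)$ be a sequence of positive integers with $r_n\ll v_n^{-1}\ll n$ (that is, $r_nv_n\to0$ and $nv_n\to\infty$), and let $m_n=\lfloor n/r_n\rfloor$ and $Y_{n,j}=(X_{n,i})_{(j-1)r_n+1\le i\le jr_n}$ for $1\le j\le m_n$;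 let $Y_n$ be a block with the law of $Y_{n,1}$. Let $\mathcal{F}$ be a class of cluster functionals such that, for each $f\in\mathcal F$, $\mathbb{E}f(Y_n)^2<\infty$ for all sufficiently large $n$, and let $c:\mathcal F\times\mathcal F\to\mathbb R$. Suppose that * (C.1) $\mathbb{E}\big[(f(Y_n)-\mathbb{E}f(Y_n))^2\,\mathbb{1}\{|f(Y_n)-\mathbb{E}f(Y_n)|>\epsilon\sqrt{nv_n}\}\big]=o(r_nv_n)$ for all $\epsilon>0$ and all $f\in\mathcal{F}$; * (C.2) $(r_nv_n)^{-1}\operatorname{Cov}(f(Y_n),g(Y_n))\to c(f,g)$ for all $f,g\in\mathcal{F}$; * for all $k$, all $(f_1,\dots,f_k)\in\mathcal{F}^k$ and all $t\in\mathbb{R}^k$, $$T_t(m_n|f_1,\dots,f_k):=\sum_{j=1}^{m_n}\Big|\operatorname{Cov}\Big(e^{i\langle t,\sum_{s=1}^{j-1}W_{n,s}\rangle},\,e^{i\langle t,W_{n,j}\rangle}\Big)\Big|\longrightarrow 0,$$ where $W_{n,j}=(nv_n)^{-1/2}\big(f_l(Y_{n,j})-\mathbb{E}f_l(Y_{n,j})\big)_{1\le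 l\le k}$ and $\operatorname{Cov}(U,V)=\mathbb{E}[UV]-\mathbb{E}[U]\mathbb{E}[V]$ for complex-valued $U,V$. Then there is a centered Gaussian process $(Z(f))_{f\in\mathcal{F}}$ with covariance function $c$ such that the finite-dimensional distributions of $$Z_n(f)=\frac{1}{\sqrt{nv_n}}\sum_{j=1}^{m_n}\big(f(Y_{n,j})-\mathbb{E}f(Y_{n,j})\big),\qquad f\in\mathcal F,$$ converge weakly to those of $Z$: for all $k$ and $(f_1,\dots,f_k)\in\mathcal{F}^k$, $(Z_n(f_1),\dots,Z_n(f_k))\to(Z(f_1),\dots,Z(f_k))$ in distribution as $n\to\infty$. -/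

import Mathlib

open MeasureTheory ProbabilityTheory Filter Topology Asymptotics

noncomputable section

namespace ClusterCLT

variable {d : ℕ} {E : Set (EuclideanSpace ℝ (Fin d))}

/-- The set of `E`-valued blocks `(x₁, …, x_r)` of arbitrary finite length `r ≥ 1`. Its σ-field is
Mathlib's σ-field of a disjoint union: a set is measurable iff its trace on each `E ^ r` is. -/
abbrev Blocks (E : Set (EuclideanSpace ℝ (Fin d))) : Type := Σ r : ℕ+, (Fin (r : ℕ) → E)

/-- The null block of length `r`. -/
def nullBlock (h0 : (0 : EuclideanSpace ℝ (Fin d)) ∈ E) (r : ℕ+) : Blocks E :=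
  ⟨r, fun _ => ⟨0, h0⟩⟩

open Classical in
/-- The positions of the non-null entries of a block. -/
def support (x : Blocks E) : Finset (Fin (x.1 : ℕ)) :=
  Finset.univ.filter fun i => (x.2 i : EuclideanSpace ℝ (Fin d)) ≠ 0

open Classical in
/-- The core of a block: the sub-block that starts at the first non-null entry and ends at the last
one; it is the null block of length one if all entries are null. -/
def core (h0 : (0 : EuclideanSpace ℝ (Fin d)) ∈ E) (x : Blocks E) : Blocks E :=
  if h : (support x).Nonempty then
    ⟨⟨((support x).max' h : ℕ) - ((support x).min' h : ℕ) + 1, Nat.succ_pos _⟩,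
      fun i => x.2 ⟨((support x).min' h : ℕ) + (i : ℕ), by
        have h1 : ((support x).min' h : ℕ) ≤ ((support x).max' h : ℕ) :=
          Fin.le_def.mp (Finset.min'_le_max' _ h)
        have h2 := ((support x).max' h).isLt
        have h3 : (i : ℕ) < ((support x).max' h : ℕ) - ((support x).min' h : ℕ) + 1 := i.isLt
        omega⟩⟩
  else nullBlock h0 1

/-- Cluster functionals: measurable maps on blocks that depend on a block only through its core and
vanish on null blocks. -/
structure IsClusterFunctional (h0 : (0 : EuclideanSpace ℝ (Fin d)) ∈ E) (f : Blocks E → ℝ) :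
    Prop where
  measurable : Measurable f
  eq_core : ∀ x, f x = f (core h0 x)
  null : ∀ r, f (nullBlock h0 r) = 0

variable {Ω : Type*}

/-- The blocks of length `r_n` of the `n`-th row, numbered from `0`: `block X r n j` consists of
the entries `X n i` with `j * r_n + 1 ≤ i ≤ (j + 1) * r_n`. The block `block X r n 0` serves as the
generic block `Y_n`. -/
def block (X : ℕ → ℕ → Ω → E) (r : ℕ → ℕ+) (n j : ℕ) (ω : Ω) : Blocks E :=
  ⟨r n, fun i => X n (j * (r n : ℕ) + (i : ℕ) + 1) ω⟩

variable [MeasurableSpace Ω]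

/-- Row-wise stationarity of the triangular array `(X n i)`, `1 ≤ i ≤ n`: in each row, windows of
equal length have the same law. Entries `X n i` with `i = 0` or `i > n` are not part of the array. -/
def RowStationary (P : Measure Ω) (X : ℕ → ℕ → Ω → E) : Prop :=
  ∀ n h k : ℕ, h + k ≤ n →
    IdentDistrib (fun ω (i : Fin k) => X n ((i : ℕ) + 1) ω)
      (fun ω (i : Fin k) => X n (h + (i : ℕ) + 1) ω) P P

/-- `v_n = P(X_{n,1} ≠ 0)`. -/
def v (P : Measure Ω) (X : ℕ → ℕ → Ω → E) (n : ℕ) : ℝ :=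
  P.real {ω | (X n 1 ω : EuclideanSpace ℝ (Fin d)) ≠ 0}

/-- The number `m_n = ⌊n / r_n⌋` of complete blocks in the `n`-th row. -/
def m (r : ℕ → ℕ+) (n : ℕ) : ℕ := n / (r n : ℕ)

/-- The centered block value `f(Y_{n,j}) - E f(Y_{n,j})`. -/
def centered (P : Measure Ω) (X : ℕ → ℕ → Ω → E) (r : ℕ → ℕ+) (f : Blocks E → ℝ) (n j : ℕ)
    (ω : Ω) : ℝ :=
  f (block X r n j ω) - ∫ ω', f (block X r n j ω') ∂P

/-- The empirical process of cluster functionals,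
`Z_n(f) = (n v_n)^{-1/2} ∑_j (f(Y_{n,j}) - E f(Y_{n,j}))`. -/
def empProcess (P : Measure Ω) (X : ℕ → ℕ → Ω → E) (r : ℕ → ℕ+) (n : ℕ) (f : Blocks E → ℝ)
    (ω : Ω) : ℝ :=
  (Real.sqrt (n * v P X n))⁻¹ * ∑ j ∈ Finset.range (m r n), centered P X r f n j ω

/-- The vector `W_{n,j}(f₁, …, f_k)` of normalized centered block values. -/
def W (P : Measure Ω) (X : ℕ → ℕ → Ω → E) (r : ℕ → ℕ+) {k : ℕ} (f : Fin k → Blocks E → ℝ)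
    (n j : ℕ) (ω : Ω) : Fin k → ℝ :=
  fun l => (Real.sqrt (n * v P X n))⁻¹ * centered P X r (f l) n j ω

/-- The (bilinear) covariance `E[UV] - E[U] E[V]` of complex random variables. -/
def complexCov (P : Measure Ω) (U V : Ω → ℂ) : ℂ :=
  ∫ ω, U ω * V ω ∂P - (∫ ω, U ω ∂P) * ∫ ω, V ω ∂P

/-- The dependence term `T_t(m_n | f₁, …, f_k)`. -/
def depTerm (P : Measure Ω) (X : ℕ → ℕ → Ω → E) (r : ℕ → ℕ+) {k : ℕ} (t : Fin k → ℝ)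
    (f : Fin k → Blocks E → ℝ) (n : ℕ) : ℝ :=
  ∑ j ∈ Finset.range (m r n),
    ‖complexCov P
      (fun ω => Complex.exp (Complex.I *
        ((dotProduct t (∑ s ∈ Finset.range j, W P X r f n s ω) : ℝ) : ℂ)))
      (fun ω => Complex.exp (Complex.I * ((dotProduct t (W P X r f n j ω) : ℝ) : ℂ)))‖

/-- The Lindeberg-type condition on the block values of `f`. -/
def LindebergCondition (P : Measure Ω) (X : ℕ → ℕ → Ω → E) (r : ℕ → ℕ+) (f : Blocks E → ℝ) :
    Prop :=
  ∀ ε : ℝ, 0 < ε →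
    (fun n : ℕ => ∫ ω in {ω | ε * Real.sqrt (n * v P X n) < |centered P X r f n 0 ω|},
      (centered P X r f n 0 ω) ^ 2 ∂P) =o[atTop] fun n : ℕ => ((r n : ℕ) : ℝ) * v P X n

end ClusterCLT

end

namespace ClusterCLT

/-! The proof works with characteristic functions. Fix `t` and let `B` be the characteristic
function at `t` of a single normalized block vector. Appending one more block to a partial sum with
characteristic function `A` produces `A * B` plus a complex covariance, because stationarity makes
`B` the same for every block. Since `‖B‖ ≤ 1`, these errors accumulate to at most `depTerm`
(`norm_charFun_sub_pow_le_depTerm`). Up to `o(1)` the blocks thus behave as if independent, and only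
the power `B ^ m_n` has to be studied.

Lindeberg's theorem (`tendsto_integral_exp_pow_of_lindeberg`) gives its limit `exp (-σ² / 2)`. By
(C.2) and `m_n r_n / n → 1`, the variance `σ²` is the quadratic form of `c` at `t`; the Lindeberg
condition passes from single functionals to linear combinations by `indicator_sq_sum_le`. Lévy's
continuity theorem then yields weak convergence.

The limit must be one process indexed by all of `F`. As a limit of normalized covariance matrices,
`c` is positive semidefinite, so the finite-dimensional Gaussian laws exist and are consistent.
Kolmogorov's extension theorem is obtained by compactness: the laws are placed in a power of
`EReal`, and a limit along an ultrafilter is represented by Riesz's theorem. -/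

/-! ### Existence of Gaussian processes with given covariance -/

/-- On a compact Hausdorff space, laws have a cluster point in the weak topology. -/
theorem exists_ultrafilter_tendsto_integral {K : Type*} [TopologicalSpace K] [CompactSpace K]
    [T2Space K] [MeasurableSpace K] [BorelSpace K]
    {α : Type*} (l : Filter α) [l.NeBot] {β : α → Type*}
    [∀ a, TopologicalSpace (β a)] [∀ a, MeasurableSpace (β a)] [∀ a, OpensMeasurableSpace (β a)]
    (μ : ∀ a, Measure (β a)) [∀ a, IsProbabilityMeasure (μ a)] (T : ∀ a, β a → K)
    (hT : ∀ a, Continuous (T a)) :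
    ∃ U : Ultrafilter α, (U : Filter α) ≤ l ∧ ∃ ν : Measure K, IsFiniteMeasure ν ∧
      ∀ g : C(K, ℝ), Tendsto (fun a => ∫ x, g (T a x) ∂μ a) U (𝓝 (∫ x, g x ∂ν)) := by
  have hbound (g : CompactlySupportedContinuousMap K ℝ) : ∃ C : ℝ, ∀ x, ‖g x‖ ≤ C := by
    obtain ⟨C, hC⟩ := (isCompact_range g.continuous).isBounded.exists_norm_le
    exact ⟨C, fun x => hC _ ⟨x, rfl⟩⟩
  have hint (g : CompactlySupportedContinuousMap K ℝ) (a : α) :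
      Integrable (fun x => g (T a x)) (μ a) := by
    obtain ⟨C, hC⟩ := hbound g
    refine .of_bound ((g.continuous.comp (hT a)).measurable.aestronglyMeasurable) C ?_
    exact .of_forall fun x => hC _
  have hlim (g : CompactlySupportedContinuousMap K ℝ) : ∃ b : ℝ,
      Tendsto (fun a => ∫ x, g (T a x) ∂μ a) (Ultrafilter.of l) (𝓝 b) := by
    obtain ⟨C, hC⟩ := hbound g
    have h := (isCompact_closedBall (0 : ℝ) C).ultrafilter_le_nhds
      ((Ultrafilter.of l).map fun a => ∫ x, g (T a x) ∂μ a) (by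
        rw [le_principal_iff]
        refine mem_map.2 (univ_mem' fun a => ?_)
        have := norm_integral_le_of_norm_le_const (μ := μ a) (f := fun x => g (T a x))
          (.of_forall fun x => hC (T a x))
        simpa using this)
    obtain ⟨b, -, hb⟩ := h
    exact ⟨b, hb⟩
  -- One ultrafilter serves all test functions at once, so the limits inherit linearity and
  -- positivity from the integrals.
  choose Λ hΛ using hlim
  let Φ : CompactlySupportedContinuousMap K ℝ →ₚ[ℝ] ℝ := .mk₀
    { toFun := Λ
      map_add' := fun f g => by
        refine tendsto_nhds_unique (hΛ (f + g)) (((hΛ f).add (hΛ g)).congr fun a => ?_)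
        rw [← integral_add (hint f a) (hint g a)]
        rfl
      map_smul' := fun c g => by
        refine tendsto_nhds_unique (hΛ (c • g)) (((hΛ g).const_mul c).congr fun a => ?_)
        rw [← integral_const_mul]
        rfl }
    (fun g hg => ge_of_tendsto' (hΛ g) fun a => integral_nonneg fun x => hg _)
  refine ⟨Ultrafilter.of l, Ultrafilter.of_le l, RealRMK.rieszMeasure Φ,
    CompactSpace.isFiniteMeasure, fun g => ?_⟩
  have h := RealRMK.integral_rieszMeasure Φ (CompactlySupportedContinuousMap.continuousMapEquiv g)
  have h' := hΛ (CompactlySupportedContinuousMap.continuousMapEquiv g)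
  change Tendsto _ _ (𝓝 (Φ _)) at h'
  rwa [← h] at h'

/-- Riesz's theorem supplies a Borel measure, while a process lives on the product σ-field, which
may be strictly smaller for an uncountable index set. -/
theorem exists_trim_integral_eq {K : Type*} {m₁ m₂ : MeasurableSpace K} (hle : m₁ ≤ m₂)
    (ν₀ : @Measure K m₂) (hν₀ : IsFiniteMeasure ν₀) :
    ∃ ν : @Measure K m₁, IsFiniteMeasure ν ∧ ∀ g : K → ℝ, Measurable[m₁] g →
      ∫ x, g x ∂ν = ∫ x, g x ∂ν₀ :=
  ⟨ν₀.trim hle, isFiniteMeasure_trim hle, fun _ hg => (integral_trim hle hg.stronglyMeasurable).symm⟩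

/-- **Kolmogorov's extension theorem** for real-valued processes. -/
theorem exists_isProjectiveLimit {ι : Type*} (P : ∀ J : Finset ι, Measure (J → ℝ))
    [∀ J, IsProbabilityMeasure (P J)] (hP : IsProjectiveMeasureFamily (α := fun _ => ℝ) P) :
    ∃ Q : Measure (ι → ℝ), IsProjectiveLimit (α := fun _ => ℝ) Q P := by
  classical
  -- Compactness comes from `EReal`; the value 0 outside `J` is arbitrary, since a fixed finite `I`
  -- is eventually contained in `J`.
  let T (J : Finset ι) (x : J → ℝ) (i : ι) : EReal :=
    if h : i ∈ J then ((x ⟨i, h⟩ : ℝ) : EReal) else 0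
  have hT (J : Finset ι) : Continuous (T J) := by
    refine continuous_pi fun i => ?_
    by_cases h : i ∈ J
    · simp only [T, h, dite_true]
      exact continuous_coe_real_ereal.comp (continuous_apply _)
    · simp only [T, h, dite_false]
      exact continuous_const
  have hle : (MeasurableSpace.pi : MeasurableSpace (ι → EReal)) ≤ borel (ι → EReal) := by
    refine iSup_le fun i => ?_
    rw [← measurable_iff_comap_le]
    have h := (continuous_apply (A := fun _ : ι => EReal) i).borel_measurable
    rwa [← BorelSpace.measurable_eq (α := EReal)] at h
  obtain ⟨U, hU, ν₀, hν₀, hlim₀⟩ := @exists_ultrafilter_tendsto_integral (ι → EReal) _ _ _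
    (borel _) (@BorelSpace.mk _ _ (borel _) rfl) _ (atTop : Filter (Finset ι)) _ _ _ _ _ P _ T hT
  obtain ⟨ν, hν, hνg⟩ := exists_trim_integral_eq hle ν₀ hν₀
  have hlim (g : C(ι → EReal, ℝ)) (hg : Measurable g) :
      Tendsto (fun J => ∫ x, g (T J x) ∂P J) U (𝓝 (∫ x, g x ∂ν)) := by
    rw [hνg g hg]
    exact hlim₀ g
  have hmarg (I : Finset ι) : ν.map I.restrict = (P I).map (fun x i => ((x i : ℝ) : EReal)) := by
    have hc : Continuous (fun (x : I → ℝ) (i : I) => ((x i : ℝ) : EReal)) :=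
      continuous_pi fun i => continuous_coe_real_ereal.comp (continuous_apply i)
    have hr : Continuous (I.restrict : (ι → EReal) → I → EReal) :=
      continuous_pi fun i => continuous_apply _
    have hrm : Measurable (I.restrict : (ι → EReal) → I → EReal) :=
      Finset.measurable_restrict I
    refine ext_of_forall_integral_eq_of_IsFiniteMeasure fun f => ?_
    rw [integral_map hrm.aemeasurable f.continuous.measurable.aestronglyMeasurable,
      integral_map hc.measurable.aemeasurable f.continuous.measurable.aestronglyMeasurable]
    refine tendsto_nhds_unique
      (hlim ⟨fun x => f (I.restrict x), f.continuous.comp hr⟩ (f.continuous.measurable.comp hrm)) ?_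
    -- By consistency the integrals no longer depend on `J` once `I ⊆ J`, so their limit along `U`
    -- is that constant value.
    refine tendsto_const_nhds.congr' (hU ?_)
    filter_upwards [eventually_ge_atTop I] with J hJ
    have h := integral_map (μ := P J) (f := fun x => f fun i => ((x i : ℝ) : EReal))
      (Finset.measurable_restrict₂ (X := fun _ => ℝ) hJ).aemeasurable
      (f.continuous.comp hc).measurable.aestronglyMeasurable
    rw [hP J I hJ]
    refine h.trans ?_
    refine integral_congr_ae (.of_forall fun x => ?_)
    change f _ = f _
    congr 1
    ext i
    simp [T, hJ i.2]
  -- Each finite marginal of `ν` is carried by real vectors, so the values that `toReal` assigns to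
  -- `±∞` play no role.
  refine ⟨ν.map fun x i => (x i).toReal, fun I => ?_⟩
  have hm : Measurable fun (x : I → EReal) (i : I) => (x i).toReal :=
    measurable_pi_lambda _ fun i => (measurable_pi_apply i).ereal_toReal
  have hm' : Measurable fun (x : ι → EReal) (i : ι) => (x i).toReal :=
    measurable_pi_lambda _ fun i => (measurable_pi_apply i).ereal_toReal
  have hc : Measurable fun (x : I → ℝ) (i : I) => ((x i : ℝ) : EReal) :=
    measurable_pi_lambda _ fun i => (measurable_pi_apply i).coe_real_ereal
  rw [Measure.map_map (Finset.measurable_restrict I) hm']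
  change ν.map ((fun (x : I → EReal) (i : I) => (x i).toReal) ∘ I.restrict) = _
  rw [← Measure.map_map hm (Finset.measurable_restrict I), hmarg, Measure.map_map hm hc]
  exact Measure.map_id

/-- Every symmetric positive semidefinite function is the covariance of a centered Gaussian
process. -/
theorem exists_isGaussianProcess {ι : Type*} (c : ι → ι → ℝ)
    (hc : ∀ I : Finset ι, (Matrix.of fun i j : I => c i j).PosSemidef) :
    ∃ Q : Measure (ι → ℝ), IsProbabilityMeasure Q ∧
      IsGaussianProcess (fun (i : ι) (x : ι → ℝ) => x i) Q ∧
      (∀ i, ∫ x, x i ∂Q = 0) ∧ ∀ i j, cov[fun x => x i, fun x => x j; Q] = c i j := by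
  classical
  let S (I : Finset ι) : Matrix I I ℝ := Matrix.of fun i j : I => c i j
  let P (I : Finset ι) : Measure (I → ℝ) :=
    (multivariateGaussian 0 (S I)).map (MeasurableEquiv.toLp 2 (I → ℝ)).symm
  have hPp (I : Finset ι) : IsProbabilityMeasure (P I) :=
    Measure.isProbabilityMeasure_map (by fun_prop)
  have hP : IsProjectiveMeasureFamily (α := fun _ => ℝ) P := by
    intro I J hJI
    have h := measurePreserving_restrict₂_multivariateGaussian (μ := 0) (hc I) hJI
    have h0 : (EuclideanSpace.restrict₂ hJI) (0 : EuclideanSpace ℝ I) = 0 := map_zero _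
    rw [h0] at h
    have h1 := Measure.map_map (μ := multivariateGaussian 0 (S I))
      (Finset.measurable_restrict₂ (X := fun _ => ℝ) hJI)
      (MeasurableEquiv.toLp 2 (I → ℝ)).symm.measurable
    have h2 := Measure.map_map (μ := multivariateGaussian 0 (S I))
      (MeasurableEquiv.toLp 2 (J → ℝ)).symm.measurable h.measurable
    rw [h.map_eq] at h2
    exact h2.trans h1.symm
  obtain ⟨Q, hQ⟩ := exists_isProjectiveLimit P hP
  have hQp : IsProbabilityMeasure Q := hQ.isProbabilityMeasure
  have hlaw (I : Finset ι) : Q.map I.restrict = P I := hQ I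
  have hrm (I : Finset ι) : Measurable (I.restrict : (ι → ℝ) → I → ℝ) :=
    Finset.measurable_restrict I
  have hm (I : Finset ι) : Measurable (MeasurableEquiv.toLp 2 (I → ℝ)).symm :=
    (MeasurableEquiv.toLp 2 (I → ℝ)).symm.measurable
  refine ⟨Q, hQp, ⟨fun I => ⟨?_⟩⟩, fun i => ?_, fun i j => ?_⟩
  · change IsGaussian (Q.map I.restrict)
    rw [hlaw]
    exact inferInstanceAs (IsGaussian ((multivariateGaussian 0 (S I)).map
      (PiLp.continuousLinearEquiv 2 ℝ (fun _ : I => ℝ))))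
  · have h1 := integral_map (μ := Q) (f := fun x => x (⟨i, by simp⟩ : ({i} : Finset ι)))
      (hrm {i}).aemeasurable (measurable_pi_apply _).aestronglyMeasurable
    have h2 := integral_map (μ := multivariateGaussian 0 (S {i}))
      (f := fun x => x (⟨i, by simp⟩ : ({i} : Finset ι))) (hm {i}).aemeasurable
      (measurable_pi_apply _).aestronglyMeasurable
    rw [hlaw] at h1
    refine h1.symm.trans (h2.trans ?_)
    have h3 := (EuclideanSpace.proj (𝕜 := ℝ) (⟨i, by simp⟩ : ({i} : Finset ι))).integral_comp_id_comm
      (IsGaussian.integrable_id (μ := multivariateGaussian 0 (S {i})))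
    rw [integral_id_multivariateGaussian, map_zero] at h3
    exact h3
  · have h1 := covariance_map (μ := Q) (X := fun x => x (⟨i, by simp⟩ : ({i, j} : Finset ι)))
      (Y := fun x => x (⟨j, by simp⟩ : ({i, j} : Finset ι)))
      (measurable_pi_apply _).aestronglyMeasurable (measurable_pi_apply _).aestronglyMeasurable
      (hrm {i, j}).aemeasurable
    have h2 := covariance_map (μ := multivariateGaussian 0 (S {i, j}))
      (X := fun x => x (⟨i, by simp⟩ : ({i, j} : Finset ι)))
      (Y := fun x => x (⟨j, by simp⟩ : ({i, j} : Finset ι)))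
      (measurable_pi_apply _).aestronglyMeasurable (measurable_pi_apply _).aestronglyMeasurable
      (hm {i, j}).aemeasurable
    rw [hlaw] at h1
    exact h1.symm.trans (h2.trans (covariance_eval_multivariateGaussian (hc _) _ _))

/-! ### Lindeberg's theorem through characteristic functions -/

/-- Second-order Taylor bound for the complex exponential on the imaginary axis. -/
theorem norm_exp_I_mul_sub_taylor_two_le {ε : ℝ} (hε0 : 0 ≤ ε) (hε : ε ≤ 1) (x : ℝ) :
    ‖Complex.exp (Complex.I * x) - 1 - Complex.I * x + ((x ^ 2 / 2 : ℝ) : ℂ)‖ ≤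
      ε * x ^ 2 + 3 * {y : ℝ | ε < |y|}.indicator (fun y => y ^ 2) x := by
  have hsmall (hx : |x| ≤ 1) :
      ‖Complex.exp (Complex.I * x) - 1 - Complex.I * x + ((x ^ 2 / 2 : ℝ) : ℂ)‖ ≤ |x| * x ^ 2 := by
    have hn : ‖Complex.I * (x : ℂ)‖ = |x| := by simp
    have h := Complex.exp_bound (x := Complex.I * x) (by rw [hn]; exact hx) (n := 3) (by norm_num)
    rw [hn] at h
    have e : Complex.exp (Complex.I * x) - 1 - Complex.I * x + ((x ^ 2 / 2 : ℝ) : ℂ) =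
        Complex.exp (Complex.I * x) -
          ∑ m ∈ Finset.range 3, (Complex.I * (x : ℂ)) ^ m / (m.factorial : ℂ) := by
      simp [Finset.sum_range_succ, mul_pow]
      ring
    rw [e]
    refine h.trans ?_
    have h3 : |x| ^ 3 = |x| * x ^ 2 := by rw [pow_succ', sq_abs]
    rw [h3]
    have : 0 ≤ |x| * x ^ 2 := by positivity
    norm_num [Nat.factorial]
    linarith
  have hx0 : 0 ≤ x ^ 2 := sq_nonneg x
  by_cases hx : ε < |x|
  · rw [Set.indicator_of_mem (by exact hx)]
    by_cases hx1 : |x| ≤ 1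
    · refine (hsmall hx1).trans ?_
      nlinarith [mul_nonneg hε0 hx0]
    -- For `|x| > 1` the three terms give `|x| + |x| + x ^ 2 / 2 ≤ 5 / 2 * x ^ 2`, whence the factor
    -- 3.
    · push Not at hx1
      have h1 : ‖Complex.exp (Complex.I * x) - 1‖ ≤ |x| := Real.norm_exp_I_mul_ofReal_sub_one_le
      have h2 : ‖Complex.I * (x : ℂ)‖ = |x| := by simp
      have h3 : ‖((x ^ 2 / 2 : ℝ) : ℂ)‖ = x ^ 2 / 2 := by
        rw [Complex.norm_real, Real.norm_of_nonneg (by positivity)]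
      have h4 := norm_add_le (Complex.exp (Complex.I * x) - 1 - Complex.I * x)
        ((x ^ 2 / 2 : ℝ) : ℂ)
      have h5 := norm_sub_le (Complex.exp (Complex.I * x) - 1) (Complex.I * x)
      have h6 : |x| ≤ x ^ 2 := by
        rw [← sq_abs]
        nlinarith
      nlinarith [mul_nonneg hε0 hx0]
  · rw [Set.indicator_of_notMem (by exact hx)]
    push Not at hx
    refine (hsmall (hx.trans hε)).trans ?_
    nlinarith

/-- Integration of the pointwise Taylor bound; centering removes the linear term. -/
theorem norm_integral_exp_I_mul_sub_taylor_le {Ω : Type*} [MeasurableSpace Ω] {P : Measure Ω}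
    [IsProbabilityMeasure P] {S : Ω → ℝ} (hS : MemLp S 2 P) (h0 : ∫ ω, S ω ∂P = 0) {ε : ℝ}
    (hε0 : 0 < ε) (hε : ε ≤ 1) :
    ‖∫ ω, Complex.exp (Complex.I * S ω) ∂P - 1 + (((∫ ω, S ω ^ 2 ∂P) / 2 : ℝ) : ℂ)‖ ≤
      ε * ∫ ω, S ω ^ 2 ∂P + 3 * ∫ ω in {ω | ε < |S ω|}, S ω ^ 2 ∂P := by
  have hm : AEMeasurable S P := hS.aestronglyMeasurable.aemeasurable
  have i1 : Integrable S P := hS.integrable (by norm_num)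
  have i2 : Integrable (fun ω => S ω ^ 2) P := hS.integrable_sq
  have hnull : NullMeasurableSet {ω | ε < |S ω|} P :=
    nullMeasurableSet_lt aemeasurable_const hm.abs
  have i3 : Integrable ({ω | ε < |S ω|}.indicator fun ω => S ω ^ 2) P := i2.indicator₀ hnull
  have ie : Integrable (fun ω => Complex.exp (Complex.I * S ω)) P := by
    refine .of_bound (C := 1) (by fun_prop) (.of_forall fun ω => ?_)
    rw [mul_comm, Complex.norm_exp_ofReal_mul_I]
  have i1c : Integrable (fun ω => Complex.I * (S ω : ℂ)) P := i1.ofReal.const_mul _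
  have i2c : Integrable (fun ω => ((S ω ^ 2 / 2 : ℝ) : ℂ)) P := (i2.div_const 2).ofReal
  have e : ∫ ω, Complex.exp (Complex.I * S ω) ∂P - 1 + (((∫ ω, S ω ^ 2 ∂P) / 2 : ℝ) : ℂ) =
      ∫ ω, (Complex.exp (Complex.I * S ω) - 1 - Complex.I * S ω + ((S ω ^ 2 / 2 : ℝ) : ℂ)) ∂P := by
    have i4 : Integrable (fun ω => Complex.exp (Complex.I * S ω) - 1) P :=
      ie.sub (integrable_const _)
    have i5 : Integrable (fun ω => Complex.exp (Complex.I * S ω) - 1 - Complex.I * S ω) P :=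
      i4.sub i1c
    rw [integral_add i5 i2c, integral_sub i4 i1c, integral_sub ie (integrable_const _),
      integral_const_mul, integral_complex_ofReal, integral_complex_ofReal, h0, integral_div]
    simp
  rw [e, ← integral_indicator₀ hnull, ← integral_const_mul, ← integral_const_mul,
    ← integral_add (i2.const_mul _) (i3.const_mul _)]
  refine norm_integral_le_of_norm_le ((i2.const_mul _).add (i3.const_mul _))
    (.of_forall fun ω => ?_)
  exact norm_exp_I_mul_sub_taylor_two_le hε0.le hε (S ω)

theorem norm_integral_exp_I_mul_le_one {Ω : Type*} [MeasurableSpace Ω] {P : Measure Ω}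
    [IsProbabilityMeasure P] (S : Ω → ℝ) : ‖∫ ω, Complex.exp (Complex.I * S ω) ∂P‖ ≤ 1 := by
  have := norm_integral_le_of_norm_le_const (μ := P)
    (f := fun ω => Complex.exp (Complex.I * S ω)) (C := 1) (.of_forall fun ω => by
      rw [mul_comm, Complex.norm_exp_ofReal_mul_I])
  simpa using this

theorem norm_pow_sub_pow_le {R : Type*} [NormedCommRing R] [NormOneClass R] {a b : R} (ha : ‖a‖ ≤ 1)
    (hb : ‖b‖ ≤ 1) (n : ℕ) : ‖a ^ n - b ^ n‖ ≤ n * ‖a - b‖ := by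
  induction n with
  | zero => simp
  | succ n ih =>
    have e : a ^ (n + 1) - b ^ (n + 1) = (a ^ n - b ^ n) * a + b ^ n * (a - b) := by ring
    have hbn : ‖b ^ n‖ ≤ 1 := (norm_pow_le b n).trans (pow_le_one₀ (norm_nonneg _) hb)
    calc ‖a ^ (n + 1) - b ^ (n + 1)‖ ≤ ‖a ^ n - b ^ n‖ * ‖a‖ + ‖b ^ n‖ * ‖a - b‖ := by
          rw [e]
          exact (norm_add_le _ _).trans (add_le_add (norm_mul_le _ _) (norm_mul_le _ _))
      _ ≤ n * ‖a - b‖ * 1 + 1 * ‖a - b‖ := by gcongr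
      _ = (n + 1 : ℕ) * ‖a - b‖ := by push_cast; ring

/-- If `‖φ n‖ ≤ 1` and `m n (φ n - 1) → z` with `m n → ∞`, then `φ n ^ m n → exp z`. -/
theorem tendsto_pow_exp_of_norm_le_one {ι : Type*} {l : Filter ι} {m : ι → ℕ} {φ : ι → ℂ} {z : ℂ}
    (hm : Tendsto m l atTop) (hφ : ∀ i, ‖φ i‖ ≤ 1)
    (h : Tendsto (fun i => (m i : ℂ) * (φ i - 1)) l (𝓝 z)) :
    Tendsto (fun i => φ i ^ m i) l (𝓝 (Complex.exp z)) := by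
  have hmr : Tendsto (fun i => ((m i : ℝ))⁻¹) l (𝓝 0) :=
    tendsto_inv_atTop_zero.comp (tendsto_natCast_atTop_atTop.comp hm)
  have hn : Tendsto (fun i => (m i : ℝ) * ‖φ i - 1‖) l (𝓝 ‖z‖) := by
    refine h.norm.congr fun i => ?_
    simp
  have hs : Tendsto (fun i => ‖φ i - 1‖) l (𝓝 0) := by
    have := hmr.mul hn
    rw [zero_mul] at this
    refine this.congr' ?_
    filter_upwards [hm.eventually_ge_atTop 1] with i hi
    have : (m i : ℝ) ≠ 0 := by positivity
    field_simp
  have he : Tendsto (fun i => Complex.exp (φ i - 1) ^ m i) l (𝓝 (Complex.exp z)) := by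
    refine (h.cexp).congr fun i => ?_
    rw [← Complex.exp_nat_mul]
  -- Both bases lie in the unit disc, the exponential because `Re (φ i) ≤ 1`. The powers therefore
  -- differ by at most `m i * ‖φ i - exp (φ i - 1)‖ ≤ m i * ‖φ i - 1‖ ^ 2`, a bounded factor times a
  -- null one.
  have hd : Tendsto (fun i => φ i ^ m i - Complex.exp (φ i - 1) ^ m i) l (𝓝 0) := by
    have hb : Tendsto (fun i => (m i : ℝ) * ‖φ i - 1‖ * ‖φ i - 1‖) l (𝓝 0) := by
      simpa using hn.mul hs
    refine squeeze_zero_norm' ?_ hb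
    filter_upwards [hs.eventually_le_const zero_lt_one] with i hi
    have h1 : ‖Complex.exp (φ i - 1)‖ ≤ 1 := by
      rw [Complex.norm_exp, Real.exp_le_one_iff, Complex.sub_re, Complex.one_re]
      linarith [(Complex.re_le_norm (φ i)).trans (hφ i)]
    refine (norm_pow_sub_pow_le (hφ i) h1 _).trans ?_
    have h2 := Complex.norm_exp_sub_one_sub_id_le hi
    rw [mul_assoc]
    refine mul_le_mul_of_nonneg_left ?_ (Nat.cast_nonneg _)
    rw [← sq, norm_sub_rev (φ i) (Complex.exp _)]
    rwa [sub_sub, add_sub_cancel] at h2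
  simpa using hd.add he

/-- **Lindeberg's theorem** for characteristic functions of identically distributed rows. -/
theorem tendsto_integral_exp_pow_of_lindeberg {Ω : Type*} [MeasurableSpace Ω] {P : Measure Ω}
    [IsProbabilityMeasure P] {ι : Type*} {l : Filter ι} {m : ι → ℕ} (hm : Tendsto m l atTop)
    {S : ι → Ω → ℝ} (hS : ∀ᶠ i in l, MemLp (S i) 2 P)
    (h0 : ∀ᶠ i in l, ∫ ω, S i ω ∂P = 0) {σ2 : ℝ}
    (hvar : Tendsto (fun i => (m i : ℝ) * ∫ ω, S i ω ^ 2 ∂P) l (𝓝 σ2))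
    (hlin : ∀ ε : ℝ, 0 < ε →
      Tendsto (fun i => (m i : ℝ) * ∫ ω in {ω | ε < |S i ω|}, S i ω ^ 2 ∂P) l (𝓝 0)) :
    Tendsto (fun i => (∫ ω, Complex.exp (Complex.I * S i ω) ∂P) ^ m i) l
      (𝓝 (Complex.exp (-((σ2 / 2 : ℝ) : ℂ)))) := by
  refine tendsto_pow_exp_of_norm_le_one hm (fun i => norm_integral_exp_I_mul_le_one _) ?_
  have hv : Tendsto (fun i => ((((m i : ℝ) * ∫ ω, S i ω ^ 2 ∂P) / 2 : ℝ) : ℂ)) l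
      (𝓝 ((σ2 / 2 : ℝ) : ℂ)) :=
    (Complex.continuous_ofReal.tendsto _).comp (hvar.div_const 2)
  have hd : Tendsto (fun i => (m i : ℂ) * (∫ ω, Complex.exp (Complex.I * S i ω) ∂P - 1) +
      ((((m i : ℝ) * ∫ ω, S i ω ^ 2 ∂P) / 2 : ℝ) : ℂ)) l (𝓝 0) := by
    rw [tendsto_zero_iff_norm_tendsto_zero, Metric.tendsto_nhds]
    intro δ hδ
    have hσ : 0 < |σ2| + 1 := by positivity
    -- The bound `ε * x ^ 2` then costs less than `δ / 2` in total, and the truncated part less than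
    -- `3 * (δ / 6)`.
    set ε : ℝ := min 1 (δ / (2 * (|σ2| + 1))) with hεdef
    have hε0 : 0 < ε := by positivity
    have hε2 : ε * (|σ2| + 1) ≤ δ / 2 := by
      calc ε * (|σ2| + 1) ≤ δ / (2 * (|σ2| + 1)) * (|σ2| + 1) := by
            gcongr
            exact min_le_right _ _
        _ = δ / 2 := by field_simp
    filter_upwards [hS, h0, hvar.eventually_lt_const (lt_of_le_of_lt (le_abs_self σ2)
      (lt_add_one |σ2|)), (hlin ε hε0).eventually_lt_const (show 0 < δ / 6 by positivity)]
      with i hSi h0i hvi hli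
    have h := norm_integral_exp_I_mul_sub_taylor_le hSi h0i hε0 (min_le_left _ _)
    have e : (m i : ℂ) * (∫ ω, Complex.exp (Complex.I * S i ω) ∂P - 1) +
        ((((m i : ℝ) * ∫ ω, S i ω ^ 2 ∂P) / 2 : ℝ) : ℂ) =
        (m i : ℂ) * (∫ ω, Complex.exp (Complex.I * S i ω) ∂P - 1 +
          (((∫ ω, S i ω ^ 2 ∂P) / 2 : ℝ) : ℂ)) := by
      push_cast
      ring
    rw [Real.dist_0_eq_abs, abs_norm, e, norm_mul, Complex.norm_natCast]
    have h2 := mul_le_mul_of_nonneg_left h (Nat.cast_nonneg (α := ℝ) (m i))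
    have h3 := mul_lt_mul_of_pos_left hvi hε0
    nlinarith
  have := hd.sub hv
  rw [zero_sub] at this
  refine this.congr fun i => ?_
  ring

/-- If the sum exceeds `ε` in absolute value, the largest of the `k` summands exceeds `ε / k`, and
the squared sum is at most `k ^ 2` times its square. -/
theorem indicator_sq_sum_le {k : ℕ} (x : Fin k → ℝ) {ε : ℝ} (hε : 0 < ε) :
    {y : ℝ | ε < |y|}.indicator (fun y => y ^ 2) (∑ l, x l) ≤
      ∑ l, (k : ℝ) ^ 2 * {y : ℝ | ε / k < |y|}.indicator (fun y => y ^ 2) (x l) := by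
  have hnn (l : Fin k) :
      0 ≤ (k : ℝ) ^ 2 * {y : ℝ | ε / k < |y|}.indicator (fun y => y ^ 2) (x l) :=
    mul_nonneg (sq_nonneg _) (Set.indicator_nonneg (fun _ _ => sq_nonneg _) _)
  by_cases h : ε < |∑ l, x l|
  · rw [Set.indicator_of_mem (by exact h)]
    rcases k.eq_zero_or_pos with rfl | hk
    · simp at h
      linarith
    have : Nonempty (Fin k) := ⟨⟨0, hk⟩⟩
    obtain ⟨l, hl⟩ := Finite.exists_max fun l => |x l|
    have hk' : (0 : ℝ) < k := by exact_mod_cast hk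
    have hs : |∑ i, x i| ≤ k * |x l| := by
      refine (Finset.abs_sum_le_sum_abs _ _).trans ?_
      refine (Finset.sum_le_card_nsmul _ _ _ fun i _ => hl i).trans ?_
      simp
    refine le_trans ?_ (Finset.single_le_sum (fun i _ => hnn i) (Finset.mem_univ l))
    rw [Set.indicator_of_mem]
    · rw [← sq_abs, ← sq_abs (x l), ← mul_pow]
      exact pow_le_pow_left₀ (abs_nonneg _) hs 2
    · change ε / k < |x l|
      rw [div_lt_iff₀' hk']
      exact h.trans_le hs
  · rw [Set.indicator_of_notMem (by exact h)]
    exact Finset.sum_nonneg fun i _ => hnn i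

/-! ### Blocks, stationarity and the comparison with independent blocks -/

theorem measurable_sigmaMk {ι : Type*} {β : ι → Type*} [∀ i, MeasurableSpace (β i)] (i : ι) :
    Measurable (Sigma.mk i : β i → Σ i, β i) :=
  fun _ hs => MeasurableSpace.measurableSet_iInf.1 hs i

variable {d : ℕ} {E : Set (EuclideanSpace ℝ (Fin d))} {Ω : Type*} [MeasurableSpace Ω]
  {P : Measure Ω} {X : ℕ → ℕ → Ω → E} {r : ℕ → ℕ+}

theorem succ_mul_le_of_lt_m {n j : ℕ} (hj : j < m r n) : (j + 1) * (r n : ℕ) ≤ n :=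
  (Nat.le_div_iff_mul_le (r n).pos).1 hj

theorem measurable_block (hX : ∀ n i : ℕ, 1 ≤ i → i ≤ n → Measurable (X n i)) {n j : ℕ}
    (hj : j < m r n) : Measurable (block X r n j) := by
  refine (measurable_sigmaMk (r n)).comp (measurable_pi_lambda _ fun i => hX _ _ (by omega) ?_)
  have := succ_mul_le_of_lt_m hj
  have := i.isLt
  rw [Nat.succ_mul] at *
  omega

theorem identDistrib_block (hstat : RowStationary P X) {n j : ℕ} (hj : j < m r n) :
    IdentDistrib (block X r n j) (block X r n 0) P P := by
  have h := succ_mul_le_of_lt_m hj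
  rw [Nat.succ_mul] at h
  have hmk := measurable_sigmaMk (β := fun r : ℕ+ => Fin (r : ℕ) → E) (r n)
  have h1 := ((hstat n (j * r n) (r n) h).comp hmk).symm
  convert h1 using 1
  · rfl
  · funext ω
    simp [block]

theorem identDistrib_centered (hstat : RowStationary P X) {n j : ℕ} (hj : j < m r n) {k : ℕ}
    {f : Fin k → Blocks E → ℝ} (hf : ∀ l, Measurable (f l)) :
    IdentDistrib (fun ω l => centered P X r (f l) n j ω) (fun ω l => centered P X r (f l) n 0 ω)
      P P := by
  have hb := identDistrib_block (r := r) hstat hj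
  have he (l : Fin k) : ∫ ω, f l (block X r n j ω) ∂P = ∫ ω, f l (block X r n 0 ω) ∂P :=
    (hb.comp (hf l)).integral_eq
  have h := hb.comp (u := fun x l => f l x - ∫ ω, f l (block X r n 0 ω) ∂P)
    (measurable_pi_lambda _ fun l => (hf l).sub_const _)
  convert h using 1
  · funext ω l
    simp [centered, he]
  · rfl

theorem dotProduct_W {k : ℕ} (t : Fin k → ℝ) (f : Fin k → Blocks E → ℝ) (n j : ℕ) (ω : Ω) :
    dotProduct t (W P X r f n j ω) =
      (Real.sqrt (n * v P X n))⁻¹ * ∑ l, t l * centered P X r (f l) n j ω := by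
  simp only [dotProduct, W, Finset.mul_sum]
  exact Finset.sum_congr rfl fun l _ => by ring

theorem sum_W {k : ℕ} (f : Fin k → Blocks E → ℝ) (n : ℕ) (ω : Ω) :
    ∑ s ∈ Finset.range (m r n), W P X r f n s ω = fun l => empProcess P X r n (f l) ω := by
  funext l
  simp [W, empProcess, Finset.mul_sum, Finset.sum_apply]

theorem integral_exp_W_eq (hstat : RowStationary P X) {n j : ℕ} (hj : j < m r n) {k : ℕ}
    {f : Fin k → Blocks E → ℝ} (hf : ∀ l, Measurable (f l)) (t : Fin k → ℝ) :
    ∫ ω, Complex.exp (Complex.I * ((dotProduct t (W P X r f n j ω) : ℝ) : ℂ)) ∂P =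
      ∫ ω, Complex.exp (Complex.I * ((dotProduct t (W P X r f n 0 ω) : ℝ) : ℂ)) ∂P := by
  simp only [dotProduct_W]
  have hu : Measurable fun y : Fin k → ℝ => Complex.exp (Complex.I *
      (((Real.sqrt (n * v P X n))⁻¹ * ∑ l, t l * y l : ℝ) : ℂ)) := by fun_prop
  exact ((identDistrib_centered hstat hj hf).comp hu).integral_eq

/-- The dependence term controls the distance of the characteristic function of the sum from that
of a sum of independent copies. -/
theorem norm_charFun_sub_pow_le_depTerm [IsProbabilityMeasure P] (hstat : RowStationary P X) {k : ℕ}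
    {f : Fin k → Blocks E → ℝ} (hf : ∀ l, Measurable (f l)) (t : Fin k → ℝ) (n : ℕ) :
    ‖∫ ω, Complex.exp (Complex.I *
          ((dotProduct t (fun l => empProcess P X r n (f l) ω) : ℝ) : ℂ)) ∂P -
        (∫ ω, Complex.exp (Complex.I * ((dotProduct t (W P X r f n 0 ω) : ℝ) : ℂ)) ∂P) ^ m r n‖ ≤
      depTerm P X r t f n := by
  set B := ∫ ω, Complex.exp (Complex.I * ((dotProduct t (W P X r f n 0 ω) : ℝ) : ℂ)) ∂P with hB
  have hB1 : ‖B‖ ≤ 1 := norm_integral_exp_I_mul_le_one _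
  simp only [← sum_W, depTerm]
  suffices h : ∀ j ≤ m r n, ‖∫ ω, Complex.exp (Complex.I *
      ((dotProduct t (∑ s ∈ Finset.range j, W P X r f n s ω) : ℝ) : ℂ)) ∂P - B ^ j‖ ≤
      ∑ j ∈ Finset.range j,
    ‖complexCov P
      (fun ω => Complex.exp (Complex.I *
        ((dotProduct t (∑ s ∈ Finset.range j, W P X r f n s ω) : ℝ) : ℂ)))
      (fun ω => Complex.exp (Complex.I * ((dotProduct t (W P X r f n j ω) : ℝ) : ℂ)))‖ from
    h _ le_rfl
  intro j
  induction j with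
  | zero => simp
  | succ j ih =>
    intro hj
    rw [Finset.sum_range_succ]
    set A := ∫ ω, Complex.exp (Complex.I *
      ((dotProduct t (∑ s ∈ Finset.range j, W P X r f n s ω) : ℝ) : ℂ)) ∂P with hA
    set C := complexCov P
      (fun ω => Complex.exp (Complex.I *
        ((dotProduct t (∑ s ∈ Finset.range j, W P X r f n s ω) : ℝ) : ℂ)))
      (fun ω => Complex.exp (Complex.I * ((dotProduct t (W P X r f n j ω) : ℝ) : ℂ))) with hC
    have e : ∫ ω, Complex.exp (Complex.I *
        ((dotProduct t (∑ s ∈ Finset.range (j + 1), W P X r f n s ω) : ℝ) : ℂ)) ∂P =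
        C + A * B := by
      rw [hC, complexCov, integral_exp_W_eq hstat hj hf, sub_add_cancel]
      refine integral_congr_ae (.of_forall fun ω => ?_)
      dsimp only
      rw [Finset.sum_range_succ, dotProduct_add, ← Complex.exp_add]
      push_cast
      rw [mul_add]
    -- Telescoping: the old error is multiplied by `B`, of norm at most 1, and one covariance is
    -- added.
    have e2 : C + A * B - B ^ (j + 1) = (A - B ^ j) * B + C := by ring
    rw [e, e2]
    refine (norm_add_le _ _).trans (add_le_add ?_ le_rfl)
    rw [norm_mul]
    exact (mul_le_of_le_one_right (norm_nonneg _) hB1).trans (ih (by omega))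

/-! ### Moments of block values and growth of the number of blocks -/

theorem memLp_centered [IsProbabilityMeasure P] {f : Blocks E → ℝ} {n j : ℕ}
    (h : MemLp (fun ω => f (block X r n j ω)) 2 P) : MemLp (centered P X r f n j) 2 P :=
  h.sub (memLp_const _)

theorem integral_centered [IsProbabilityMeasure P] {f : Blocks E → ℝ} {n j : ℕ}
    (h : MemLp (fun ω => f (block X r n j ω)) 2 P) : ∫ ω, centered P X r f n j ω ∂P = 0 := by
  have hi : Integrable (fun ω => f (block X r n j ω)) P := h.integrable (by norm_num)
  simp only [centered]
  rw [integral_sub hi (integrable_const _)]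
  simp

theorem integral_sq_sum_centered [IsProbabilityMeasure P] {ι : Type*} [Fintype ι]
    {f : ι → Blocks E → ℝ} {n : ℕ} (h : ∀ l, MemLp (fun ω => f l (block X r n 0 ω)) 2 P)
    (t : ι → ℝ) :
    ∫ ω, (∑ l, t l * centered P X r (f l) n 0 ω) ^ 2 ∂P =
      ∑ i, ∑ j, t i * t j * cov[fun ω => f i (block X r n 0 ω),
        fun ω => f j (block X r n 0 ω); P] := by
  have hint (i j : ι) : Integrable (fun ω => t i * t j *
      (centered P X r (f i) n 0 ω * centered P X r (f j) n 0 ω)) P :=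
    ((memLp_centered (h i)).integrable_mul (memLp_centered (h j))).const_mul _
  have e (ω : Ω) : (∑ l, t l * centered P X r (f l) n 0 ω) ^ 2 = ∑ i, ∑ j, t i * t j *
      (centered P X r (f i) n 0 ω * centered P X r (f j) n 0 ω) := by
    rw [sq, Finset.sum_mul_sum]
    exact Finset.sum_congr rfl fun i _ => Finset.sum_congr rfl fun j _ => by ring
  simp only [e]
  rw [integral_finsetSum _ fun i _ => integrable_finsetSum _ fun j _ => hint i j]
  refine Finset.sum_congr rfl fun i _ => ?_
  rw [integral_finsetSum _ fun j _ => hint i j]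
  exact Finset.sum_congr rfl fun j _ => integral_const_mul _ _

/-- The factor `v_n` cancels in the quotient of `r_n v_n → 0` by `n v_n → ∞`. -/
theorem tendsto_blockLength_div
    (hrv : Tendsto (fun n : ℕ => ((r n : ℕ) : ℝ) * v P X n) atTop (𝓝 0))
    (hnv : Tendsto (fun n : ℕ => (n : ℝ) * v P X n) atTop atTop) :
    Tendsto (fun n : ℕ => ((r n : ℕ) : ℝ) / n) atTop (𝓝 0) := by
  refine (hrv.div_atTop hnv).congr' ?_
  filter_upwards [hnv.eventually_gt_atTop 0] with n hn
  exact mul_div_mul_right _ _ (right_ne_zero_of_mul hn.ne')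

theorem m_mul_le (n : ℕ) : (m r n : ℝ) * ((r n : ℕ) : ℝ) ≤ n := by
  exact_mod_cast Nat.div_mul_le_self n (r n)

theorem lt_m_add_one_mul (n : ℕ) : (n : ℝ) < ((m r n : ℝ) + 1) * ((r n : ℕ) : ℝ) := by
  have := Nat.lt_div_mul_add (a := n) (r n).pos
  rw [add_one_mul]
  exact_mod_cast this

theorem tendsto_m_mul_div
    (hr : Tendsto (fun n : ℕ => ((r n : ℕ) : ℝ) / n) atTop (𝓝 0)) :
    Tendsto (fun n : ℕ => (m r n : ℝ) * ((r n : ℕ) : ℝ) / n) atTop (𝓝 1) := by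
  have h1 : Tendsto (fun n : ℕ => 1 - ((r n : ℕ) : ℝ) / n) atTop (𝓝 1) := by
    simpa using tendsto_const_nhds.sub hr
  refine tendsto_of_tendsto_of_tendsto_of_le_of_le' h1 tendsto_const_nhds ?_ ?_
  · filter_upwards [eventually_gt_atTop 0] with n hn
    have hn' : (0 : ℝ) < n := by exact_mod_cast hn
    have := lt_m_add_one_mul (r := r) n
    rw [le_div_iff₀ hn', sub_mul, div_mul_cancel₀ _ hn'.ne']
    linarith
  · filter_upwards [eventually_gt_atTop 0] with n hn
    have hn' : (0 : ℝ) < n := by exact_mod_cast hn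
    rw [div_le_one hn']
    exact m_mul_le n

theorem tendsto_m (hr : Tendsto (fun n : ℕ => ((r n : ℕ) : ℝ) / n) atTop (𝓝 0)) :
    Tendsto (m r) atTop atTop := by
  rw [← tendsto_natCast_atTop_iff (R := ℝ)]
  have h1 : Tendsto (fun n : ℕ => (((r n : ℕ) : ℝ) / n)⁻¹) atTop atTop := by
    refine tendsto_inv_nhdsGT_zero.comp (tendsto_nhdsWithin_iff.2 ⟨hr, ?_⟩)
    filter_upwards [eventually_gt_atTop 0] with n hn
    have := (r n).pos
    exact Set.mem_Ioi.2 (by positivity)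
  have h2 := tendsto_atTop_add_const_right atTop (-1 : ℝ) h1
  refine tendsto_atTop_mono (fun n => ?_) h2
  have := lt_m_add_one_mul (r := r) n
  have hr0 : (0 : ℝ) < ((r n : ℕ) : ℝ) := by exact_mod_cast (r n).pos
  rw [inv_div]
  have := (div_lt_iff₀ hr0).2 this
  linarith

/-! ### Limiting variance and Lindeberg condition for linear combinations -/

variable {d : ℕ} {E : Set (EuclideanSpace ℝ (Fin d))} {Ω : Type*} [MeasurableSpace Ω]
  {P : Measure Ω} [IsProbabilityMeasure P] {X : ℕ → ℕ → Ω → E} {r : ℕ → ℕ+}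

theorem tendsto_sum_mul_cov {ι : Type*} [Fintype ι] {f : ι → Blocks E → ℝ} {c : ι → ι → ℝ}
    (hC2 : ∀ i j, Tendsto (fun n : ℕ => (((r n : ℕ) : ℝ) * v P X n)⁻¹ *
        cov[fun ω => f i (block X r n 0 ω), fun ω => f j (block X r n 0 ω); P]) atTop
      (𝓝 (c i j)))
    (hL2 : ∀ i, ∀ᶠ n in atTop, MemLp (fun ω => f i (block X r n 0 ω)) 2 P) (t : ι → ℝ) :
    Tendsto (fun n : ℕ => (((r n : ℕ) : ℝ) * v P X n)⁻¹ *
        ∫ ω, (∑ l, t l * centered P X r (f l) n 0 ω) ^ 2 ∂P) atTop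
      (𝓝 (∑ i, ∑ j, t i * t j * c i j)) := by
  have h : Tendsto (fun n : ℕ => ∑ i, ∑ j, t i * t j * ((((r n : ℕ) : ℝ) * v P X n)⁻¹ *
      cov[fun ω => f i (block X r n 0 ω), fun ω => f j (block X r n 0 ω); P])) atTop
      (𝓝 (∑ i, ∑ j, t i * t j * c i j)) :=
    tendsto_finsetSum _ fun i _ => tendsto_finsetSum _ fun j _ => (hC2 i j).const_mul _
  refine h.congr' ?_
  filter_upwards [eventually_all.2 hL2] with n hn
  rw [integral_sq_sum_centered hn, Finset.mul_sum]
  refine Finset.sum_congr rfl fun i _ => ?_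
  rw [Finset.mul_sum]
  exact Finset.sum_congr rfl fun j _ => by ring

/-- The quadratic form of `c` is a limit of normalized second moments of linear combinations, and
symmetry survives the limit. -/
theorem posSemidef_of_tendsto_cov {ι : Type*} [Fintype ι] {f : ι → Blocks E → ℝ}
    {c : ι → ι → ℝ}
    (hC2 : ∀ i j, Tendsto (fun n : ℕ => (((r n : ℕ) : ℝ) * v P X n)⁻¹ *
        cov[fun ω => f i (block X r n 0 ω), fun ω => f j (block X r n 0 ω); P]) atTop
      (𝓝 (c i j)))
    (hL2 : ∀ i, ∀ᶠ n in atTop, MemLp (fun ω => f i (block X r n 0 ω)) 2 P) :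
    (Matrix.of c).PosSemidef := by
  refine .of_dotProduct_mulVec_nonneg ?_ fun x => ?_
  · ext i j
    simp only [Matrix.conjTranspose_apply, Matrix.of_apply, star_trivial]
    refine tendsto_nhds_unique (hC2 j i) ((hC2 i j).congr fun n => ?_)
    rw [covariance_comm]
  · have h := ge_of_tendsto' (tendsto_sum_mul_cov hC2 hL2 x) (b := 0) fun n =>
      mul_nonneg (inv_nonneg.2 (mul_nonneg (Nat.cast_nonneg _) measureReal_nonneg))
        (integral_nonneg fun ω => sq_nonneg _)
    refine h.trans_eq ?_
    simp only [dotProduct, Matrix.mulVec, Finset.mul_sum, star_trivial, Matrix.of_apply]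
    exact Finset.sum_congr rfl fun i _ => Finset.sum_congr rfl fun j _ => by ring

theorem tendsto_lindeberg_sum (hnv : Tendsto (fun n : ℕ => (n : ℝ) * v P X n) atTop atTop)
    {k : ℕ} {f : Fin k → Blocks E → ℝ}
    (hL2 : ∀ l, ∀ᶠ n in atTop, MemLp (fun ω => f l (block X r n 0 ω)) 2 P)
    (hC1 : ∀ l, LindebergCondition P X r (f l)) (t : Fin k → ℝ) {ε : ℝ} (hε : 0 < ε) :
    Tendsto (fun n : ℕ => (m r n : ℝ) *
      ∫ ω in {ω | ε < |dotProduct t (W P X r f n 0 ω)|}, dotProduct t (W P X r f n 0 ω) ^ 2 ∂P)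
      atTop (𝓝 0) := by
  rcases k.eq_zero_or_pos with rfl | hk
  · simp [dotProduct]
  have hk' : (0 : ℝ) < k := by exact_mod_cast hk
  -- If `|t l * W l| > ε / k`, the centered value exceeds `δ l * sqrt (n v_n)`; the `+ 1` covers `t
  -- l = 0`.
  let δ (l : Fin k) : ℝ := ε / k / (|t l| + 1)
  have hδ (l : Fin k) : 0 < δ l := by positivity
  let J (n : ℕ) (l : Fin k) : ℝ :=
    ∫ ω in {ω | δ l * Real.sqrt (n * v P X n) < |centered P X r (f l) n 0 ω|},
      centered P X r (f l) n 0 ω ^ 2 ∂P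
  have hJ0 (n : ℕ) (l : Fin k) : 0 ≤ J n l := integral_nonneg fun _ => sq_nonneg _
  have hJ : Tendsto (fun n : ℕ => ∑ l, (k : ℝ) ^ 2 * t l ^ 2 *
      (J n l / (((r n : ℕ) : ℝ) * v P X n))) atTop (𝓝 0) := by
    have := tendsto_finsetSum (Finset.univ : Finset (Fin k)) fun l _ =>
      ((hC1 l (δ l) (hδ l)).tendsto_div_nhds_zero).const_mul ((k : ℝ) ^ 2 * t l ^ 2)
    simpa only [mul_zero, Finset.sum_const_zero] using this
  refine squeeze_zero' (.of_forall fun n => mul_nonneg (Nat.cast_nonneg _)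
    (integral_nonneg fun _ => sq_nonneg _)) ?_ hJ
  filter_upwards [eventually_all.2 hL2, hnv.eventually_gt_atTop 0, eventually_gt_atTop 0]
    with n hn hnv0 hn0
  have hn' : (0 : ℝ) < n := by exact_mod_cast hn0
  have hv0 : 0 < v P X n := pos_of_mul_pos_right hnv0 hn'.le
  have hr0 : (0 : ℝ) < ((r n : ℕ) : ℝ) := by exact_mod_cast (r n).pos
  set a := Real.sqrt (n * v P X n) with ha
  have ha0 : 0 < a := Real.sqrt_pos.2 hnv0
  have ha2 : a ^ 2 = n * v P X n := Real.sq_sqrt hnv0.le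
  have hS : MemLp (fun ω => dotProduct t (W P X r f n 0 ω)) 2 P := by
    simp only [dotProduct_W]
    exact (memLp_finsetSum _ fun l _ => (memLp_centered (hn l)).const_mul _).const_mul _
  have hnull (l : Fin k) : NullMeasurableSet {ω | δ l * a < |centered P X r (f l) n 0 ω|} P :=
    nullMeasurableSet_lt aemeasurable_const
      (memLp_centered (hn l)).aestronglyMeasurable.aemeasurable.abs
  have hnullS : NullMeasurableSet {ω | ε < |dotProduct t (W P X r f n 0 ω)|} P :=
    nullMeasurableSet_lt aemeasurable_const hS.aestronglyMeasurable.aemeasurable.abs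
  have hint (l : Fin k) : Integrable ({ω | δ l * a < |centered P X r (f l) n 0 ω|}.indicator
      fun ω => centered P X r (f l) n 0 ω ^ 2) P :=
    (memLp_centered (hn l)).integrable_sq.indicator₀ (hnull l)
  have hpt (ω : Ω) : {ω | ε < |dotProduct t (W P X r f n 0 ω)|}.indicator
      (fun ω => dotProduct t (W P X r f n 0 ω) ^ 2) ω ≤
      ∑ l, (k : ℝ) ^ 2 * t l ^ 2 * (a ^ 2)⁻¹ *
        {ω | δ l * a < |centered P X r (f l) n 0 ω|}.indicator
          (fun ω => centered P X r (f l) n 0 ω ^ 2) ω := by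
    have h := indicator_sq_sum_le (fun l => t l * W P X r f n 0 ω l) hε
    refine le_trans (le_of_eq rfl) (h.trans (Finset.sum_le_sum fun l _ => ?_))
    rw [mul_assoc, mul_assoc]
    refine mul_le_mul_of_nonneg_left ?_ (sq_nonneg _)
    have hx : t l * W P X r f n 0 ω l = t l * (a⁻¹ * centered P X r (f l) n 0 ω) := rfl
    by_cases hlt : ε / k < |t l * W P X r f n 0 ω l|
    · have hmem : ω ∈ {ω | δ l * a < |centered P X r (f l) n 0 ω|} := by
        change δ l * a < _
        rw [hx, abs_mul, abs_mul, abs_of_pos (inv_pos.2 ha0)] at hlt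
        have h1 : ε / k * a < |t l| * |centered P X r (f l) n 0 ω| := by
          calc ε / k * a < |t l| * (a⁻¹ * |centered P X r (f l) n 0 ω|) * a := by gcongr
            _ = _ := by field_simp
        have h2 : ε / k * a < (|t l| + 1) * |centered P X r (f l) n 0 ω| := by
          nlinarith [abs_nonneg (centered P X r (f l) n 0 ω)]
        calc δ l * a = ε / k * a / (|t l| + 1) := by simp only [δ]; ring
          _ < _ := by
            rw [div_lt_iff₀' (by positivity)]
            exact h2
      rw [Set.indicator_of_mem (by exact hlt), Set.indicator_of_mem hmem, hx]
      apply le_of_eq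
      field_simp
    · rw [Set.indicator_of_notMem (by exact hlt)]
      exact mul_nonneg (sq_nonneg _) (mul_nonneg (by positivity)
        (Set.indicator_nonneg (fun _ _ => sq_nonneg _) _))
  have hle : ∫ ω in {ω | ε < |dotProduct t (W P X r f n 0 ω)|},
      dotProduct t (W P X r f n 0 ω) ^ 2 ∂P ≤ ∑ l, (k : ℝ) ^ 2 * t l ^ 2 * (a ^ 2)⁻¹ * J n l := by
    rw [← integral_indicator₀ hnullS]
    refine (integral_mono (hS.integrable_sq.indicator₀ hnullS)
      (integrable_finsetSum _ fun l _ => (hint l).const_mul _) hpt).trans_eq ?_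
    rw [integral_finsetSum _ fun l _ => (hint l).const_mul _]
    refine Finset.sum_congr rfl fun l _ => ?_
    rw [integral_const_mul, integral_indicator₀ (hnull l)]
  refine (mul_le_mul_of_nonneg_left hle (Nat.cast_nonneg _)).trans ?_
  rw [Finset.mul_sum]
  refine Finset.sum_le_sum fun l _ => ?_
  -- Since `m_n r_n ≤ n`, the normalization `m_n / (n v_n)` is dominated by the `1 / (r_n v_n)` of
  -- (C.1).
  have hm : (m r n : ℝ) * (a ^ 2)⁻¹ ≤ (((r n : ℕ) : ℝ) * v P X n)⁻¹ := by
    rw [ha2, ← div_eq_mul_inv, ← one_div, div_le_div_iff₀ hnv0 (by positivity)]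
    have := m_mul_le (r := r) n
    nlinarith
  calc (m r n : ℝ) * ((k : ℝ) ^ 2 * t l ^ 2 * (a ^ 2)⁻¹ * J n l)
      = (k : ℝ) ^ 2 * t l ^ 2 * (J n l * ((m r n : ℝ) * (a ^ 2)⁻¹)) := by ring
    _ ≤ (k : ℝ) ^ 2 * t l ^ 2 * (J n l * (((r n : ℕ) : ℝ) * v P X n)⁻¹) := by
        have := hJ0 n l
        gcongr
    _ = _ := by rw [div_eq_mul_inv]

theorem tendsto_charFun_empProcess (hstat : RowStationary P X)
    (hrv : Tendsto (fun n : ℕ => ((r n : ℕ) : ℝ) * v P X n) atTop (𝓝 0))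
    (hnv : Tendsto (fun n : ℕ => (n : ℝ) * v P X n) atTop atTop)
    {k : ℕ} {f : Fin k → Blocks E → ℝ} (hf : ∀ l, Measurable (f l))
    (hL2 : ∀ l, ∀ᶠ n in atTop, MemLp (fun ω => f l (block X r n 0 ω)) 2 P)
    (hC1 : ∀ l, LindebergCondition P X r (f l)) {c : Fin k → Fin k → ℝ}
    (hC2 : ∀ i j, Tendsto (fun n : ℕ => (((r n : ℕ) : ℝ) * v P X n)⁻¹ *
        cov[fun ω => f i (block X r n 0 ω), fun ω => f j (block X r n 0 ω); P]) atTop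
      (𝓝 (c i j))) {t : Fin k → ℝ}
    (hT : Tendsto (fun n : ℕ => depTerm P X r t f n) atTop (𝓝 0)) :
    Tendsto (fun n => ∫ ω, Complex.exp (Complex.I *
        ((dotProduct t (fun l => empProcess P X r n (f l) ω) : ℝ) : ℂ)) ∂P) atTop
      (𝓝 (Complex.exp (-(((∑ i, ∑ j, t i * t j * c i j) / 2 : ℝ) : ℂ)))) := by
  have hr := tendsto_blockLength_div hrv hnv
  have hvar : Tendsto (fun n => (m r n : ℝ) * ∫ ω, dotProduct t (W P X r f n 0 ω) ^ 2 ∂P) atTop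
      (𝓝 (∑ i, ∑ j, t i * t j * c i j)) := by
    -- The variance normalization factors as `m_n / (n v_n) = (m_n r_n / n) * (r_n v_n)⁻¹`.
    have h := (tendsto_m_mul_div hr).mul (tendsto_sum_mul_cov hC2 hL2 t)
    rw [one_mul] at h
    refine h.congr' ?_
    filter_upwards [hnv.eventually_gt_atTop 0, eventually_gt_atTop 0] with n hnv0 hn0
    have hn' : (0 : ℝ) < n := by exact_mod_cast hn0
    have hv0 : 0 < v P X n := pos_of_mul_pos_right hnv0 hn'.le
    have hr0 : (0 : ℝ) < ((r n : ℕ) : ℝ) := by exact_mod_cast (r n).pos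
    simp only [dotProduct_W, mul_pow, inv_pow, Real.sq_sqrt hnv0.le]
    rw [integral_const_mul]
    field_simp
  have hpow := tendsto_integral_exp_pow_of_lindeberg (P := P) (tendsto_m hr)
    (S := fun n ω => dotProduct t (W P X r f n 0 ω)) (by
      filter_upwards [eventually_all.2 hL2] with n hn
      simp only [dotProduct_W]
      exact (memLp_finsetSum _ fun l _ => (memLp_centered (hn l)).const_mul _).const_mul _) (by
      filter_upwards [eventually_all.2 hL2] with n hn
      simp only [dotProduct_W]
      rw [integral_const_mul, integral_finsetSum _ fun l _ =>
        ((memLp_centered (hn l)).integrable (by norm_num)).const_mul _]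
      simp [integral_const_mul, integral_centered (hn _)])
    hvar (fun ε hε => tendsto_lindeberg_sum hnv hL2 hC1 t hε)
  have hd := squeeze_zero_norm (norm_charFun_sub_pow_le_depTerm hstat hf t) hT
  simpa using hd.add hpow

/-! ### Convergence of the finite-dimensional distributions -/

theorem charFun_map_toLp {Ω : Type*} [MeasurableSpace Ω] {P : Measure Ω} {k : ℕ}
    {V : Ω → Fin k → ℝ} (hV : Measurable fun ω => WithLp.toLp 2 (V ω)) (t : EuclideanSpace ℝ (Fin k)) :
    charFun (P.map fun ω => WithLp.toLp 2 (V ω)) t =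
      ∫ ω, Complex.exp (Complex.I * ((dotProduct t.ofLp (V ω) : ℝ) : ℂ)) ∂P := by
  rw [charFun_apply, integral_map hV.aemeasurable (by fun_prop)]
  refine integral_congr_ae (.of_forall fun ω => ?_)
  simp [PiLp.inner_apply, dotProduct, mul_comm]

end ClusterCLT

theorem theorem1 {d : ℕ} {E : Set (EuclideanSpace ℝ (Fin d))}
    (h0 : (0 : EuclideanSpace ℝ (Fin d)) ∈ E)
    {Ω : Type*} [MeasurableSpace Ω] (P : Measure Ω) [IsProbabilityMeasure P]
    (X : ℕ → ℕ → Ω → E)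
    (hX : ∀ n i : ℕ, 1 ≤ i → i ≤ n → Measurable (X n i))
    (hstat : ClusterCLT.RowStationary P X)
    (r : ℕ → ℕ+)
    -- the growth conditions `r_n ≪ 1 / v_n ≪ n`
    (hrv : Tendsto (fun n : ℕ => ((r n : ℕ) : ℝ) * ClusterCLT.v P X n) atTop (𝓝 0))
    (hnv : Tendsto (fun n : ℕ => (n : ℝ) * ClusterCLT.v P X n) atTop atTop)
    (F : Set (ClusterCLT.Blocks E → ℝ))
    (hF : ∀ f ∈ F, ClusterCLT.IsClusterFunctional h0 f)
    -- the block values have finite second moments, so that the covariances below exist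
    (hL2 : ∀ f ∈ F, ∀ᶠ n in atTop, MemLp (fun ω => f (ClusterCLT.block X r n 0 ω)) 2 P)
    (hC1 : ∀ f ∈ F, ClusterCLT.LindebergCondition P X r f)
    (c : F → F → ℝ)
    (hC2 : ∀ f g : F, Tendsto
      (fun n : ℕ => (((r n : ℕ) : ℝ) * ClusterCLT.v P X n)⁻¹ *
        cov[fun ω => f.1 (ClusterCLT.block X r n 0 ω),
          fun ω => g.1 (ClusterCLT.block X r n 0 ω); P]) atTop (𝓝 (c f g)))
    (hT : ∀ (k : ℕ) (t : Fin k → ℝ) (f : Fin k → F),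
      Tendsto (fun n : ℕ => ClusterCLT.depTerm P X r t (fun l => (f l).1) n) atTop (𝓝 0)) :
    ∃ (Ω' : Type) (_ : MeasurableSpace Ω') (P' : Measure Ω') (_ : IsProbabilityMeasure P')
      (Z : F → Ω' → ℝ),
      IsGaussianProcess Z P' ∧ (∀ f, ∫ ω, Z f ω ∂P' = 0) ∧
      (∀ f g, cov[Z f, Z g; P'] = c f g) ∧
      ∀ (k : ℕ) (f : Fin k → F),
        TendstoInDistribution
          (fun (n : ℕ) (ω : Ω) (l : Fin k) => ClusterCLT.empProcess P X r n (f l).1 ω) atTop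
          (fun (ω : Ω') (l : Fin k) => Z (f l) ω) (fun _ => P) P' := by
  obtain ⟨P', hP', hG, hZ0, hZc⟩ := ClusterCLT.exists_isGaussianProcess c fun I =>
    ClusterCLT.posSemidef_of_tendsto_cov (f := fun i : I => i.1.1)
      (fun i j => hC2 i.1 j.1) (fun i => hL2 _ i.1.2)
  refine ⟨F → ℝ, inferInstance, P', hP', fun f x => x f, hG, hZ0, hZc, fun k f => ?_⟩
  have hfm (l : Fin k) : Measurable (f l).1 := (hF _ (f l).2).measurable
  have hem (n : ℕ) (l : Fin k) :
      Measurable fun ω => ClusterCLT.empProcess P X r n (f l).1 ω := by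
    refine Measurable.const_mul (Finset.measurable_sum _ fun j hj => ?_) _
    exact ((hfm l).comp (ClusterCLT.measurable_block hX (Finset.mem_range.1 hj))).sub_const _
  -- Characteristic functions require an inner product, so convergence is proved in Euclidean space
  -- and transferred by the continuous map `WithLp.ofLp`.
  suffices h : TendstoInDistribution (fun (n : ℕ) (ω : Ω) =>
      WithLp.toLp 2 fun l : Fin k => ClusterCLT.empProcess P X r n (f l).1 ω) atTop
      (fun x : F → ℝ => WithLp.toLp 2 fun l : Fin k => x (f l)) (fun _ => P) P' from
    h.continuous_comp (g := WithLp.ofLp) (PiLp.continuous_ofLp 2 _)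
  have hm (n : ℕ) : Measurable fun ω =>
      WithLp.toLp 2 fun l : Fin k => ClusterCLT.empProcess P X r n (f l).1 ω :=
    (WithLp.measurable_toLp 2 _).comp (measurable_pi_lambda _ fun l => hem n l)
  have hmZ : Measurable fun x : F → ℝ => WithLp.toLp 2 fun l : Fin k => x (f l) :=
    (WithLp.measurable_toLp 2 _).comp (measurable_pi_lambda _ fun l => measurable_pi_apply _)
  refine ⟨fun n => (hm n).aemeasurable, hmZ.aemeasurable, ?_⟩
  refine ProbabilityMeasure.tendsto_of_tendsto_charFun fun t => ?_
  have hlim := ClusterCLT.tendsto_charFun_empProcess hstat hrv hnv hfm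
    (fun l => hL2 _ (f l).2) (fun l => hC1 _ (f l).2) (fun i j => hC2 (f i) (f j)) (hT k t f)
  have hgauss : ∫ x, Complex.exp (Complex.I *
      ((dotProduct t.ofLp (fun l => x (f l)) : ℝ) : ℂ)) ∂P' =
      Complex.exp (-(((∑ i, ∑ j, t i * t j * c (f i) (f j)) / 2 : ℝ) : ℂ)) := by
    have hGl : HasGaussianLaw (fun x : F → ℝ => ∑ l, t l * x (f l)) P' :=
      ((hG.comp_right f).smul fun l => t l).hasGaussianLaw_fun_sum (I := Finset.univ)
    have hL (g : F) : MemLp (fun x : F → ℝ => x g) 2 P' := (hG.hasGaussianLaw_eval g).memLp_two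
    -- The joint characteristic function at `t` is that of the real Gaussian variable `∑ l, t l * x
    -- (f l)` at 1.
    have h1 := hGl.charFun_map_eq (1 : ℝ)
    have hmean : ∫ x : F → ℝ, ∑ l, t l * x (f l) ∂P' = 0 := by
      rw [integral_finsetSum _ fun l _ => ((hL (f l)).integrable (by norm_num)).const_mul _]
      simp [integral_const_mul, hZ0]
    have hvar : Var[fun x : F → ℝ => ∑ l, t l * x (f l); P'] =
        ∑ i, ∑ j, t i * t j * c (f i) (f j) := by
      rw [← covariance_self hGl.aemeasurable,
        covariance_fun_sum_fun_sum (fun l => (hL (f l)).const_mul _)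
          (fun l => (hL (f l)).const_mul _)]
      simp only [covariance_const_mul_left, covariance_const_mul_right, hZc]
      exact Finset.sum_congr rfl fun i _ => Finset.sum_congr rfl fun j _ => by ring
    rw [charFun_apply, integral_map hGl.aemeasurable (by fun_prop)] at h1
    simp only [RCLike.inner_apply, conj_trivial, mul_one, one_mul, hmean, hvar] at h1
    convert h1 using 1
    · refine integral_congr_ae (.of_forall fun x => ?_)
      simp [dotProduct, mul_comm]
    · simp
  have e : charFun (P'.map fun x : F → ℝ => WithLp.toLp 2 fun l : Fin k => x (f l)) t =
      Complex.exp (-(((∑ i, ∑ j, t i * t j * c (f i) (f j)) / 2 : ℝ) : ℂ)) :=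
    (ClusterCLT.charFun_map_toLp hmZ t).trans hgauss
  change Tendsto (fun n => charFun (P.map _) t) atTop (𝓝 (charFun (P'.map _) t))
  rw [e]
  exact hlim.congr fun n => (ClusterCLT.charFun_map_toLp (hm n) t).symm
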